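/- Let $D\in\{1,2,3,7,11,19,43,67,163\}$ (the square-free positive integers for which $\mathbb{Q}(\sqrt{-D})$ has class number one), and let $\mathcal{O}_D$ be the ring of integers of $\mathbb{Q}(\sqrt{-D})$. Put $\omega=\frac{1+\sqrt{-D}}{2}$ if $D\equiv 3\pmod 4$ and $\omega=\sqrt{-D}$ otherwise, and identify $(x,y)\in\mathbb{R}^2$ with $x+\omega y\in\mathbb{C}$, so that $\mathcal{O}_D\subset\mathbb{R}^2$. For real $r>0$ let $$C_D(r)=\begin{cases}\{(x,y)\in\mathbb{R}^2: x^2+Dy^2=r\} & \text{if } D\equiv 1,2\pmod 4,\\ \{(x,y)\in\mathbb{R}^2: x^2+xy+\tfrac{1+D}{4}y^2=r\} & \text{if } D\equiv 3\pmod 4,\end{cases}$$ and let $\Lambda_D^r=\mathcal{O}_D\cap C_D(r)$ be the norm $r$ shell. For $j\ge 1$ let $H_{D,j}$ be the real vector space of polynomials in $x,y$ spanned by $\operatorname{Re}(x+\omega y)^j$ and $\operatorname{Im}(x+\omega y)^j$. For a set $T$ of positive integers, a finite nonempty set $X\subset C_D(r)$ is called an ellipsoidal $T$-design if $\sum_{(x,y)\in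 X}P(x,y)=0$ for all $j\in T$ and all $P\in H_{D,j}$; it is said to have strength $T$ if $T$ is maximal (with respect to inclusion) among the sets of positive integers for which $X$ is an ellipsoidal design. Let $u_D=4$ if $D=1$, $u_D=6$ if $D=3$, and $u_D=2$ otherwise, and let $T_D=\mathbb{Z}^+\setminus u_D\mathbb{Z}^+$. Then, for every $r>0$ for which $\Lambda_D^r$ is nonempty, $\Lambda_D^r$ is an ellipsoidal $T_D$-design with strength $T_D$. Moreover, for every positive multiple $j$ of $u_D$, $$\sum_{(x,y)\in\Lambda_D^r}\operatorname{Re}(x+\omega y)^j\neq 0 .$$ -/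

import Mathlib

open MvPolynomial

noncomputable section

namespace EllipsoidalDesign

/-- The square root `√(-D) = i√D` in `ℂ`. -/
def sqrtNeg (D : ℕ) : ℂ := (Real.sqrt D : ℂ) * Complex.I

/-- The generator `ω` of the ring of integers: `(1 + √(-D))/2` if `D ≡ 3 mod 4`,
and `√(-D)` otherwise. -/
def omega (D : ℕ) : ℂ := if D % 4 = 3 then (1 + sqrtNeg D) / 2 else sqrtNeg D

/-- The norm `r` ellipse `C_D(r)` in `ℝ²`. -/
def ellipse (D : ℕ) (r : ℝ) : Set (ℝ × ℝ) :=
  if D % 4 = 3 then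
    {p | p.1 ^ 2 + p.1 * p.2 + (1 + (D : ℝ)) / 4 * p.2 ^ 2 = r}
  else
    {p | p.1 ^ 2 + (D : ℝ) * p.2 ^ 2 = r}

/-- The complex number `x + ω y` with coordinates `(x, y)`. -/
def toComplex (D : ℕ) (p : ℝ × ℝ) : ℂ := (p.1 : ℂ) + omega D * (p.2 : ℂ)

/-- The imaginary quadratic field `ℚ(√(-D))`, as a subfield of `ℂ`. -/
abbrev quadField (D : ℕ) : IntermediateField ℚ ℂ := IntermediateField.adjoin ℚ {sqrtNeg D}

/-- The ring of integers `O_D` of `ℚ(√(-D))`, as a lattice in `ℝ²` through the coordinates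
`(x, y) ↦ x + ω y`. -/
def ringOfIntegersLattice (D : ℕ) : Set (ℝ × ℝ) :=
  {p | ∃ a : NumberField.RingOfIntegers (quadField D), ((a : quadField D) : ℂ) = toComplex D p}

/-- The norm `r` shell `Λ_D^r = O_D ∩ C_D(r)`. -/
def shell (D : ℕ) (r : ℝ) : Set (ℝ × ℝ) := ringOfIntegersLattice D ∩ ellipse D r

/-- The polynomial with real coefficients obtained from a complex polynomial by taking the real
part of each coefficient; at real points it is the real part. -/
def rePart (P : MvPolynomial (Fin 2) ℂ) : MvPolynomial (Fin 2) ℝ :=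
  ∑ m ∈ P.support, monomial m (P.coeff m).re

/-- The polynomial with real coefficients obtained from a complex polynomial by taking the
imaginary part of each coefficient; at real points it is the imaginary part. -/
def imPart (P : MvPolynomial (Fin 2) ℂ) : MvPolynomial (Fin 2) ℝ :=
  ∑ m ∈ P.support, monomial m (P.coeff m).im

/-- The complex polynomial `(x + ω y)^j`. -/
def omegaPow (D j : ℕ) : MvPolynomial (Fin 2) ℂ := (X 0 + C (omega D) * X 1) ^ j

/-- The real vector space `H_{D,j}` spanned by `Re (x + ω y)^j` and `Im (x + ω y)^j`. -/
def harmonicSpace (D j : ℕ) : Submodule ℝ (MvPolynomial (Fin 2) ℝ) :=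
  Submodule.span ℝ {rePart (omegaPow D j), imPart (omegaPow D j)}

/-- A finite nonempty subset `X` of `C_D(r)` is an ellipsoidal `T`-design if every polynomial in
`H_{D,j}` with `j ∈ T` sums to zero over `X`. -/
def IsDesign (D : ℕ) (r : ℝ) (X : Set (ℝ × ℝ)) (T : Set ℕ+) : Prop :=
  X.Finite ∧ X.Nonempty ∧ X ⊆ ellipse D r ∧
    ∀ j ∈ T, ∀ P ∈ harmonicSpace D (j : ℕ), ∑ᶠ p ∈ X, eval ![p.1, p.2] P = 0

/-- `X` has strength `T` if `T` is maximal among the sets of positive integers for which `X` is an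
ellipsoidal design. -/
def HasStrength (D : ℕ) (r : ℝ) (X : Set (ℝ × ℝ)) (T : Set ℕ+) : Prop :=
  Maximal (IsDesign D r X) T

/-- The number `u_D`: `4` if `D = 1`, `6` if `D = 3`, and `2` otherwise. -/
def unitCount (D : ℕ) : ℕ := if D = 1 then 4 else if D = 3 then 6 else 2

/-- The set `T_D` of the positive integers that are not multiples of `u_D`. -/
def designSet (D : ℕ) : Set ℕ+ := {j | ¬ unitCount D ∣ (j : ℕ)}

theorem eval_rePart (P : MvPolynomial (Fin 2) ℂ) (x y : ℝ) :
    eval ![x, y] (rePart P) = (eval ![(x : ℂ), (y : ℂ)] P).re := by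
  rw [rePart, map_sum, eval_eq', Complex.re_sum]
  refine Finset.sum_congr rfl fun m _ => ?_
  rw [eval_monomial, Finsupp.prod_fintype _ _ (by simp)]
  simp only [Fin.prod_univ_two, Matrix.cons_val_zero, Matrix.cons_val_one]
  rw [← Complex.ofReal_pow, ← Complex.ofReal_pow, ← Complex.ofReal_mul, Complex.re_mul_ofReal]

theorem eval_imPart (P : MvPolynomial (Fin 2) ℂ) (x y : ℝ) :
    eval ![x, y] (imPart P) = (eval ![(x : ℂ), (y : ℂ)] P).im := by
  rw [imPart, map_sum, eval_eq', Complex.im_sum]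
  refine Finset.sum_congr rfl fun m _ => ?_
  rw [eval_monomial, Finsupp.prod_fintype _ _ (by simp)]
  simp only [Fin.prod_univ_two, Matrix.cons_val_zero, Matrix.cons_val_one]
  rw [← Complex.ofReal_pow, ← Complex.ofReal_pow, ← Complex.ofReal_mul, Complex.im_mul_ofReal]

end EllipsoidalDesign

end

/-!
For the listed `D` the only reduced form of the discriminant of `ℤ[ω]` is the principal one. Form
reduction, read on ideals as passing from `(c, k + ω)` to the equivalent ideal `(c', -(k + b) + ω)`,
where `N(k + ω) = c c'` and `b` is the trace of `ω`, then shows that every ideal of `ℤ[ω]` is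
principal. In particular `ℤ[ω]` is the full ring of integers, and a shell consists of the elements
of a given norm.

Multiplication by an element `u` of norm one permutes a shell, so the `j`-th power sum `S` of the
shell satisfies `S = u ^ j S`; this gives `S = 0` unless `u_D ∣ j`. If `u_D ∣ j`, the shell through
`z` is taken apart prime by prime. A prime `p ∣ z` that divides its conjugate `p'` divides every
element of the shell and contributes the factor `p ^ j` to `S`. Any other prime `p ∣ z` contributes
a factor `∑_{i + l = k} (p ^ i p' ^ l) ^ j`, in which exactly one term is not divisible by `p`. What
is left in the end is the number of units, so `S ≠ 0`; and `S` is real because the shell is stable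
under conjugation.
-/

namespace EllipsoidalDesign

section PrimeFactor

open Finset

variable {R : Type*} [CommRing R]

theorem sum_antidiagonal_pow_mul_pow_ne_zero {p q : R} (hp : Prime p) (hpq : ¬ p ∣ q) {j : ℕ}
    (hj : j ≠ 0) (k : ℕ) : ∑ x ∈ antidiagonal k, (p ^ x.1 * q ^ x.2) ^ j ≠ 0 := by
  intro hsum
  have hmem : (0, k) ∈ antidiagonal k := by simp
  have hrest : p ∣ ∑ x ∈ (antidiagonal k).erase (0, k), (p ^ x.1 * q ^ x.2) ^ j := by
    refine dvd_sum fun x hx => ?_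
    obtain ⟨hne, hx⟩ := mem_erase.1 hx
    have hfst : x.1 ≠ 0 := fun h => hne ((HasAntidiagonal.antidiagonal_congr hx hmem).2 h)
    exact dvd_pow ((dvd_pow_self p hfst).mul_right _) hj
  rw [← add_sum_erase _ _ hmem] at hsum
  have hpow : p ∣ (p ^ 0 * q ^ k) ^ j := (dvd_add_left hrest).1 (hsum ▸ dvd_zero p)
  rw [pow_zero, one_mul] at hpow
  exact hpq (hp.dvd_of_dvd_pow (hp.dvd_of_dvd_pow hpow))

variable [IsDomain R]

theorem eq_of_pow_mul_eq_pow_mul {p c x y : R} {a b : ℕ} (hc : c ≠ 0) (hpc : p ∣ c)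
    (hx : ¬ p ∣ x) (hy : ¬ p ∣ y) (h : c ^ a * x = c ^ b * y) : a = b := by
  wlog hab : a < b generalizing a b x y
  · exact (not_lt.1 hab).eq_or_lt.elim Eq.symm fun hlt => (this hy hx h.symm hlt).symm
  obtain ⟨d, rfl⟩ := Nat.exists_eq_add_of_lt hab
  rw [add_assoc, pow_add, mul_assoc] at h
  have hxy := mul_left_cancel₀ (pow_ne_zero a hc) h
  exact absurd (hxy ▸ (hpc.trans (dvd_pow_self c d.succ_ne_zero)).mul_right y) hx

theorem exists_eq_pow_mul_pow_mul [WfDvdMonoid R] {p q z : R} (hp : Prime p) (hq : Prime q)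
    (hz : z ≠ 0) : ∃ (i l : ℕ) (w : R), z = p ^ i * q ^ l * w ∧ ¬ p ∣ w ∧ ¬ q ∣ w := by
  obtain ⟨i, z', hpz', rfl⟩ := WfDvdMonoid.max_power_factor hz hp.irreducible
  obtain ⟨l, w, hqw, rfl⟩ :=
    WfDvdMonoid.max_power_factor (right_ne_zero_of_mul hz) hq.irreducible
  exact ⟨i, l, w, (mul_assoc _ _ _).symm, fun h => hpz' (h.mul_left _), hqw⟩

theorem finsum_mem_image_mul_pow {c : R} (hc : c ≠ 0) (s : Set R) (j : ℕ) :
    ∑ᶠ z ∈ (c * ·) '' s, z ^ j = c ^ j * ∑ᶠ z ∈ s, z ^ j := by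
  rw [finsum_mem_image (mul_right_injective₀ hc).injOn, mul_finsum_mem]
  simp only [mul_pow]

end PrimeFactor

section NormShell

variable {R : Type*} [CommRing R] [StarRing R]

/-- The elements of relative norm `n` in a commutative ring with involution, where the relative norm
of `z` is `z * star z`. It is the algebraic counterpart of `shell`. -/
def normShell (n : R) : Set R := {z | z * star z = n}

/-- The `j`-th power sum over the elements of relative norm `n`. Like every `finsum` over an
infinite set, it may be the junk value `0` when `normShell n` is infinite. -/
noncomputable def shellPowerSum (j : ℕ) (n : R) : R := ∑ᶠ z ∈ normShell n, z ^ j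

theorem star_shellPowerSum {n : R} (hfin : (normShell n).Finite) (j : ℕ) :
    star (shellPowerSum j n) = shellPowerSum j n := by
  have hmaps : Set.MapsTo star (normShell n) (normShell n) := fun z hz => by
    rwa [normShell, Set.mem_ofPred_eq, star_star, mul_comm]
  calc star (shellPowerSum j n)
      = ∑ᶠ z ∈ normShell n, star (z ^ j) :=
        (starAddEquiv : R ≃+ R).toAddMonoidHom.map_finsum_mem _ hfin
    _ = shellPowerSum j n := finsum_mem_eq_of_bijOn star
        (Set.InvOn.bijOn ⟨fun z _ => star_star z, fun z _ => star_star z⟩ hmaps hmaps)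
        fun z _ => star_pow z j

theorem star_dvd_of_dvd_star {p y : R} (h : p ∣ star y) : star p ∣ y := by
  simpa only [starRingEnd_apply, star_star] using map_dvd (starRingEnd R) h

theorem dvd_of_mem_normShell {p n y : R} (hp : Prime p) (hself : p ∣ star p)
    (hy : y ∈ normShell (p * star p * n)) : p ∣ y := by
  have hdvd : p ∣ y * star y := ⟨star p * n, by rw [← mul_assoc]; exact hy⟩
  exact (hp.dvd_or_dvd hdvd).elim id fun h => hself.trans (star_dvd_of_dvd_star h)

theorem not_dvd_mul_star {p w : R} (hp : Prime p) (hpw : ¬ p ∣ w) (hqw : ¬ star p ∣ w) :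
    ¬ p ∣ w * star w := fun h =>
  (hp.dvd_or_dvd h).elim hpw fun h => hqw (star_dvd_of_dvd_star h)

theorem prime_star {p : R} (hp : Prime p) : Prime (star p) :=
  (MulEquiv.prime_iff (starMulAut : R ≃* R)).2 hp

theorem pow_mul_pow_mul_star (p : R) (i l : ℕ) :
    p ^ i * star p ^ l * star (p ^ i * star p ^ l) = (p * star p) ^ (i + l) := by
  simp only [star_mul', star_pow, star_star]
  ring

theorem shellPowerSum_one_ne_zero [CharZero R] (hfin : (normShell (1 : R)).Finite) {j : ℕ}
    (hunit : ∀ u ∈ unitary R, u ^ j = 1) : shellPowerSum j (1 : R) ≠ 0 := by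
  have hone : ∀ u ∈ normShell (1 : R), u ^ j = 1 := fun u hu =>
    hunit u (Unitary.mem_iff_self_mul_star.2 hu)
  rw [shellPowerSum, finsum_mem_congr rfl hone, finsum_mem_eq_finite_toFinset_sum _ hfin,
    Finset.sum_const, nsmul_one, Nat.cast_ne_zero, Finset.card_ne_zero]
  exact ⟨1, by simp [normShell]⟩

variable [IsDomain R]

theorem mul_mem_normShell_iff {c n w : R} (hc : c ≠ 0) :
    c * w ∈ normShell (c * star c * n) ↔ w ∈ normShell n := by
  have hnorm : c * w * star (c * w) = c * star c * (w * star w) := by rw [star_mul']; ring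
  rw [normShell, Set.mem_ofPred_eq, hnorm]
  exact mul_right_inj' (mul_ne_zero hc (star_ne_zero.2 hc))

theorem shellPowerSum_mul {c n : R} (hc : c ≠ 0)
    (hdvd : ∀ y ∈ normShell (c * star c * n), c ∣ y) (j : ℕ) :
    shellPowerSum j (c * star c * n) = c ^ j * shellPowerSum j n := by
  have himage : normShell (c * star c * n) = (c * ·) '' normShell n := by
    refine Set.Subset.antisymm (fun y hy => ?_) ?_
    · obtain ⟨w, rfl⟩ := hdvd y hy
      exact ⟨w, (mul_mem_normShell_iff hc).1 hy, rfl⟩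
    · rintro _ ⟨w, hw, rfl⟩
      exact (mul_mem_normShell_iff hc).2 hw
  rw [shellPowerSum, himage, finsum_mem_image_mul_pow hc, shellPowerSum]

theorem shellPowerSum_eq_zero {u : R} (hu : u ∈ unitary R) {j : ℕ} (huj : u ^ j ≠ 1) (n : R) :
    shellPowerSum j n = 0 := by
  have hnorm : u * star u = 1 := Unitary.mul_star_self_of_mem hu
  have hunit : IsUnit u := .of_mul_eq_one _ hnorm
  have hsum := shellPowerSum_mul (n := n) hunit.ne_zero (fun y _ => hunit.dvd) j
  rw [hnorm, one_mul] at hsum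
  exact (mul_left_eq_self₀.1 hsum.symm).resolve_left huj

section Split

open Finset

variable {p m : R}

theorem normShell_pow_mul [WfDvdMonoid R] (hp : Prime p) (hm : ¬ p ∣ m) (k : ℕ) :
    normShell ((p * star p) ^ k * m) =
      ⋃ x ∈ antidiagonal k, (p ^ x.1 * star p ^ x.2 * ·) '' normShell m := by
  have hq := prime_star hp
  have hne (i l : ℕ) : p ^ i * star p ^ l ≠ 0 :=
    mul_ne_zero (pow_ne_zero i hp.ne_zero) (pow_ne_zero l hq.ne_zero)
  have hpq : p * star p ≠ 0 := mul_ne_zero hp.ne_zero hq.ne_zero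
  ext y
  simp only [Set.mem_iUnion, HasAntidiagonal.mem_antidiagonal, Set.mem_image, Prod.exists]
  constructor
  · intro hy
    have hy0 : y ≠ 0 := by
      rintro rfl
      rw [normShell, Set.mem_ofPred_eq, zero_mul, eq_comm, mul_eq_zero] at hy
      exact hy.elim (pow_ne_zero k hpq) fun h => hm (h ▸ dvd_zero p)
    obtain ⟨i, l, w, rfl, hpw, hqw⟩ := exists_eq_pow_mul_pow_mul hp hq hy0
    have hnorm : (p * star p) ^ (i + l) * (w * star w) = (p * star p) ^ k * m := by
      rw [← hy, star_mul', ← pow_mul_pow_mul_star]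
      ring
    have hil : i + l = k :=
      eq_of_pow_mul_eq_pow_mul hpq (dvd_mul_right p _) (not_dvd_mul_star hp hpw hqw) hm hnorm
    rw [← hil, ← pow_mul_pow_mul_star] at hy
    exact ⟨i, l, hil, w, (mul_mem_normShell_iff (hne i l)).1 hy, rfl⟩
  · rintro ⟨i, l, rfl, w, hw, rfl⟩
    rw [← pow_mul_pow_mul_star]
    exact (mul_mem_normShell_iff (hne i l)).2 hw

theorem pairwiseDisjoint_image_mul_normShell (hp : Prime p) (hsplit : ¬ p ∣ star p)
    (hm : ¬ p ∣ m) (k : ℕ) : (antidiagonal k : Set (ℕ × ℕ)).PairwiseDisjoint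
      fun x => (p ^ x.1 * star p ^ x.2 * ·) '' normShell m := by
  have hndvd {w : R} (hw : w ∈ normShell m) (l : ℕ) : ¬ p ∣ star p ^ l * w := fun h =>
    (hp.dvd_or_dvd h).elim (fun h => hsplit (hp.dvd_of_dvd_pow h)) fun h =>
      hm (hw ▸ h.mul_right _)
  refine fun x hx x' hx' hne => Set.disjoint_left.2 ?_
  rintro _ ⟨w, hw, rfl⟩ ⟨w', hw', heq⟩
  simp only [mul_assoc] at heq
  have hfst := eq_of_pow_mul_eq_pow_mul hp.ne_zero dvd_rfl (hndvd hw' x'.2) (hndvd hw x.2) heq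
  exact hne ((HasAntidiagonal.antidiagonal_congr hx hx').2 hfst.symm)

theorem shellPowerSum_pow_mul [WfDvdMonoid R] (hp : Prime p) (hsplit : ¬ p ∣ star p)
    (hm : ¬ p ∣ m) (hfin : (normShell m).Finite) (k j : ℕ) :
    shellPowerSum j ((p * star p) ^ k * m) =
      (∑ x ∈ antidiagonal k, (p ^ x.1 * star p ^ x.2) ^ j) * shellPowerSum j m := by
  have hne (x : ℕ × ℕ) : p ^ x.1 * star p ^ x.2 ≠ 0 :=
    mul_ne_zero (pow_ne_zero _ hp.ne_zero) (pow_ne_zero _ (prime_star hp).ne_zero)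
  rw [shellPowerSum, normShell_pow_mul hp hm]
  refine (finsum_mem_biUnion (pairwiseDisjoint_image_mul_normShell hp hsplit hm k)
    (finite_toSet _) fun x _ => hfin.image _).trans ?_
  rw [finsum_mem_coe_finset, sum_mul]
  exact sum_congr rfl fun x _ => finsum_mem_image_mul_pow (hne x) _ j

end Split

open Finset in
theorem exists_shellPowerSum_eq_mul [UniqueFactorizationMonoid R] {j : ℕ} (hj : j ≠ 0)
    (hfin : ∀ n : R, (normShell n).Finite) {p z : R} (hp : Prime p) (hpz : p ∣ z) (hz : z ≠ 0) :
    ∃ c w : R, c ≠ 0 ∧ DvdNotUnit w z ∧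
      shellPowerSum j (z * star z) = c * shellPowerSum j (w * star w) := by
  by_cases hself : p ∣ star p
  · obtain ⟨w, rfl⟩ := hpz
    refine ⟨p ^ j, w, pow_ne_zero j hp.ne_zero,
      ⟨right_ne_zero_of_mul hz, p, hp.not_isUnit, mul_comm p w⟩, ?_⟩
    have hnorm : p * w * star (p * w) = p * star p * (w * star w) := by rw [star_mul']; ring
    rw [hnorm, shellPowerSum_mul hp.ne_zero fun y => dvd_of_mem_normShell hp hself]
  · obtain ⟨i, l, w, rfl, hpw, hqw⟩ := exists_eq_pow_mul_pow_mul hp (prime_star hp) hz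
    refine ⟨∑ x ∈ antidiagonal (i + l), (p ^ x.1 * star p ^ x.2) ^ j, w,
      sum_antidiagonal_pow_mul_pow_ne_zero hp hself hj _,
      ⟨right_ne_zero_of_mul hz, p ^ i * star p ^ l, fun hu => hpw ?_, mul_comm _ w⟩, ?_⟩
    · exact hu.dvd_mul_left.1 hpz
    · have hnorm : p ^ i * star p ^ l * w * star (p ^ i * star p ^ l * w) =
          (p * star p) ^ (i + l) * (w * star w) := by
        rw [star_mul', ← pow_mul_pow_mul_star]
        ring
      rw [hnorm, shellPowerSum_pow_mul hp hself (not_dvd_mul_star hp hpw hqw) (hfin _)]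

theorem shellPowerSum_ne_zero [UniqueFactorizationMonoid R] [CharZero R] {j : ℕ} (hj : j ≠ 0)
    (hfin : ∀ n : R, (normShell n).Finite) (hunit : ∀ u ∈ unitary R, u ^ j = 1) {z : R}
    (hz : z ≠ 0) : shellPowerSum j (z * star z) ≠ 0 := by
  induction z using IsWellFounded.induction (DvdNotUnit (α := R)) with
  | ind z ih =>
    by_cases hzu : IsUnit z
    · have hsum := shellPowerSum_mul (n := 1) hz (fun y _ => hzu.dvd) j
      rw [mul_one] at hsum
      rw [hsum]
      exact mul_ne_zero (pow_ne_zero j hz) (shellPowerSum_one_ne_zero (hfin 1) hunit)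
    · obtain ⟨p, hirr, hpz⟩ := WfDvdMonoid.exists_irreducible_factor hzu hz
      obtain ⟨c, w, hc, hwz, hsum⟩ := exists_shellPowerSum_eq_mul hj hfin hirr.prime hpz hz
      rw [hsum]
      exact mul_ne_zero hc (ih w hwz hwz.1)

end NormShell

section QuadraticAlgebra

open QuadraticAlgebra

section Norm

variable {R : Type*} [CommRing R] {a b : R}

theorem four_mul_norm (z : QuadraticAlgebra R a b) :
    4 * norm z = (2 * z.re + b * z.im) ^ 2 - (b ^ 2 + 4 * a) * z.im ^ 2 := by
  rw [norm_def]
  ring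

theorem mem_normShell_algebraMap {n : R} {z : QuadraticAlgebra R a b} :
    z ∈ normShell (algebraMap R (QuadraticAlgebra R a b) n) ↔ norm z = n := by
  rw [normShell, Set.mem_ofPred_eq, ← algebraMap_norm_eq_mul_star, algebraMap_inj]

theorem norm_eq_re_of_mem_normShell {n z : QuadraticAlgebra R a b} (hz : z ∈ normShell n) :
    norm z = n.re := by
  rw [normShell, Set.mem_ofPred_eq, ← algebraMap_norm_eq_mul_star] at hz
  rw [← hz, algebraMap_re]

variable [LinearOrder R] [IsStrictOrderedRing R] (hdiscr : b ^ 2 + 4 * a < 0)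
include hdiscr

theorem norm_eq_zero_iff_of_discr_neg {z : QuadraticAlgebra R a b} : norm z = 0 ↔ z = 0 := by
  refine ⟨fun hz => ?_, fun hz => hz ▸ QuadraticAlgebra.norm_zero⟩
  have hsum := four_mul_norm z
  have hsq : 0 ≤ -(b ^ 2 + 4 * a) * z.im ^ 2 :=
    mul_nonneg (neg_nonneg.2 hdiscr.le) (sq_nonneg z.im)
  have him : z.im = 0 := by
    refine pow_eq_zero_iff two_ne_zero |>.1 ((mul_eq_zero_iff_left (neg_pos.2 hdiscr).ne').1 ?_)
    nlinarith [sq_nonneg (2 * z.re + b * z.im)]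
  rw [hz, him] at hsum
  exact QuadraticAlgebra.ext (by simpa using hsum.symm) him

theorem isDomain_of_discr_neg : IsDomain (QuadraticAlgebra R a b) := by
  have : NoZeroDivisors (QuadraticAlgebra R a b) := ⟨fun {x y} hxy => by
    have hnorm : norm x * norm y = 0 := by rw [← map_mul, hxy, QuadraticAlgebra.norm_zero]
    simpa only [mul_eq_zero, norm_eq_zero_iff_of_discr_neg hdiscr] using hnorm⟩
  exact NoZeroDivisors.to_isDomain _

end Norm

theorem finite_normShell_of_discr_neg {a b : ℤ} (hdiscr : b ^ 2 + 4 * a < 0)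
    (n : QuadraticAlgebra ℤ a b) : (normShell n).Finite := by
  have hinj : Function.Injective fun z : QuadraticAlgebra ℤ a b => (2 * z.re + b * z.im, z.im) := by
    intro z w h
    obtain ⟨hre, him⟩ := Prod.mk.inj h
    exact QuadraticAlgebra.ext (by rw [him] at hre; omega) him
  refine ((((Set.finite_Icc (-(4 * n.re)) (4 * n.re)).prod
    (Set.finite_Icc (-(4 * n.re)) (4 * n.re))).preimage hinj.injOn)).subset fun z hz => ?_
  have hsum := four_mul_norm z
  rw [norm_eq_re_of_mem_normShell hz] at hsum
  have hmem {x : ℤ} (hx : x ^ 2 ≤ 4 * n.re) : x ∈ Set.Icc (-(4 * n.re)) (4 * n.re) :=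
    abs_le.1 (by nlinarith [Int.natAbs_le_self_sq x, Int.abs_eq_natAbs x])
  exact ⟨hmem (by nlinarith [sq_nonneg z.im]),
    hmem (x := z.im) (by nlinarith [sq_nonneg z.im, sq_nonneg (2 * z.re + b * z.im)])⟩

section Ideal

open Ideal

theorem isPrincipal_of_span_singleton_mul_eq {R : Type*} [CommRing R] [IsDomain R] {x y : R}
    {I J : Ideal R} (hx : x ≠ 0) (h : span {x} * I = span {y} * J) (hJ : J.IsPrincipal) :
    I.IsPrincipal := by
  obtain ⟨d, rfl⟩ := hJ
  rw [submodule_span_eq, span_singleton_mul_span_singleton] at h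
  obtain ⟨w, hw⟩ : x ∣ y * d := by
    rw [← mem_span_singleton]
    exact Ideal.mul_le_left (I := span {x}) (J := I) (h ▸ mem_span_singleton_self (y * d))
  refine ⟨w, ?_⟩
  rwa [hw, ← span_singleton_mul_span_singleton, span_singleton_mul_right_inj hx] at h

variable {R : Type*} [CommRing R] {a b : R}

theorem span_pair_add_mul (c k t : R) :
    (span {.C c, ⟨k + c * t, 1⟩} : Ideal (QuadraticAlgebra R a b)) = span {.C c, ⟨k, 1⟩} := by
  have hshift : (⟨k + c * t, 1⟩ : QuadraticAlgebra R a b) = ⟨k, 1⟩ + .C t * .C c := by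
    ext <;> simp [mul_comm]
  rw [hshift, span_pair_add_mul_left]

theorem span_star_mul_span_pair {c c' k : R}
    (hnorm : norm (⟨k, 1⟩ : QuadraticAlgebra R a b) = c * c') :
    (span {star ⟨k, 1⟩} * span {.C c, ⟨k, 1⟩} : Ideal (QuadraticAlgebra R a b)) =
      span {.C c} * span {.C c', ⟨-(k + b), 1⟩} := by
  have hmul : star ⟨k, 1⟩ * ⟨k, 1⟩ = (.C c * .C c' : QuadraticAlgebra R a b) := by
    rw [mul_comm, ← algebraMap_norm_eq_mul_star, hnorm,
      ← QuadraticAlgebra.C_eq_algebraMap, QuadraticAlgebra.C_mul]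
  have hstar : star ⟨k, 1⟩ = -(⟨-(k + b), 1⟩ : QuadraticAlgebra R a b) := by
    ext <;> simp [add_comm]
  simp only [span_mul_span', Set.singleton_mul, Set.image_pair]
  rw [hmul, mul_comm (star _), hstar, mul_neg, span_pair_comm, span_pair_neg]

theorem C_dvd_of_forall_dvd_im {I : Ideal (QuadraticAlgebra R a b)} {g : R}
    (hg : ∀ z ∈ I, g ∣ z.im) {z : QuadraticAlgebra R a b} (hz : z ∈ I) : .C g ∣ z := by
  refine algebraMap_dvd_iff.2 ⟨?_, hg z hz⟩
  have hωz : g ∣ z.re + b * z.im := by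
    simpa using hg _ (I.mul_mem_left QuadraticAlgebra.omega hz)
  exact (dvd_add_left ((hg z hz).mul_left b)).1 hωz

theorem eq_span_pair_of_forall_C_dvd {I : Ideal (QuadraticAlgebra R a b)} {g n k : R}
    (hn : ∀ {m}, .C m ∈ I ↔ n ∣ m) (hg : ∀ {z}, z ∈ I → .C g ∣ z) (hk : .C g * ⟨k, 1⟩ ∈ I) :
    I = span {.C n, .C g * ⟨k, 1⟩} := by
  refine le_antisymm (fun z hz => ?_) (span_le.2 ?_)
  · rw [mem_span_pair]
    obtain ⟨w, rfl⟩ := hg hz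
    have hsplit : .C g * w = .C (g * (w.re - w.im * k)) + .C w.im * (.C g * ⟨k, 1⟩) := by
      ext <;> simp <;> ring
    have hint : .C (g * (w.re - w.im * k)) ∈ I :=
      (I.add_mem_iff_left (I.mul_mem_left _ hk)).1 (hsplit ▸ hz)
    obtain ⟨t, ht⟩ := hn.1 hint
    exact ⟨.C t, .C w.im, by rw [hsplit, ht, mul_comm n, QuadraticAlgebra.C_mul]⟩
  · rintro _ (rfl | rfl)
    exacts [hn.2 dvd_rfl, hk]

variable [IsDomain R] [IsPrincipalIdealRing R]

theorem exists_eq_span_singleton_mul_span_pair (I : Ideal (QuadraticAlgebra R a b)) :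
    ∃ g c k : R, c ∣ norm (⟨k, 1⟩ : QuadraticAlgebra R a b) ∧
      I = span {.C g} * span {.C c, ⟨k, 1⟩} := by
  obtain ⟨g, hg⟩ :=
    IsPrincipalIdealRing.principal ((I.restrictScalars R).map (imₗ a b) : Ideal R)
  obtain ⟨n, hn⟩ := IsPrincipalIdealRing.principal (I.comap (algebraMap R _))
  have hn_dvd {m : R} : .C m ∈ I ↔ n ∣ m := by
    rw [← mem_span_singleton, ← submodule_span_eq, ← hn, mem_comap,
      QuadraticAlgebra.C_eq_algebraMap]
  have hg_dvd {z} (hz : z ∈ I) : .C g ∣ z := by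
    refine C_dvd_of_forall_dvd_im (fun w hw => ?_) hz
    rw [← mem_span_singleton, ← submodule_span_eq, ← hg]
    exact ⟨w, hw, rfl⟩
  rcases eq_or_ne g 0 with rfl | hg0
  · refine ⟨0, 1, 0, one_dvd _, ?_⟩
    rw [QuadraticAlgebra.C_zero, span_singleton_zero, Ideal.bot_mul]
    exact (Submodule.eq_bot_iff I).2 fun z hz =>
      zero_dvd_iff.1 (QuadraticAlgebra.C_zero (R := R) ▸ hg_dvd hz)
  obtain ⟨y, hyI, hy⟩ : g ∈ (I.restrictScalars R).map (imₗ a b) := by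
    rw [hg]
    exact mem_span_singleton_self g
  obtain ⟨⟨k, l⟩, rfl⟩ := hg_dvd hyI
  obtain rfl : l = 1 := by simpa [hg0] using hy
  obtain ⟨c, rfl⟩ : g ∣ n := by
    simpa using (algebraMap_dvd_iff.1 (hg_dvd (hn_dvd.2 dvd_rfl))).1
  refine ⟨g, c, k, ?_, ?_⟩
  · rw [← mul_dvd_mul_iff_left hg0, ← hn_dvd, QuadraticAlgebra.C_mul,
      QuadraticAlgebra.C_eq_algebraMap, algebraMap_norm_eq_mul_star, ← mul_assoc]
    exact I.mul_mem_right _ hyI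
  · rw [span_mul_span', Set.singleton_mul, Set.image_pair, ← QuadraticAlgebra.C_mul]
    exact eq_span_pair_of_forall_C_dvd hn_dvd hg_dvd hyI

end Ideal

/-- Every reduced positive definite form `A x ^ 2 + B x y + C y ^ 2` (`|B| ≤ A ≤ C`) of
discriminant `Δ` has `A = 1`. For a fundamental discriminant this says that the class number
is one. -/
def OnlyPrincipalReduced (Δ : ℤ) : Prop :=
  ∀ A B C : ℤ, 0 < A → |B| ≤ A → A ≤ C → B ^ 2 - 4 * A * C = Δ → A = 1

section PrincipalIdeal

open Ideal

variable {a b : ℤ}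

theorem exists_abs_add_two_mul_mul_le (m : ℤ) {c : ℤ} (hc : 0 < c) :
    ∃ t : ℤ, |m + 2 * c * t| ≤ c := by
  have hdiv := Int.emod_add_mul_ediv (m + c) (2 * c)
  have hnonneg := Int.emod_nonneg (m + c) (by omega : 2 * c ≠ 0)
  have hlt := Int.emod_lt_of_pos (m + c) (by omega : 0 < 2 * c)
  exact ⟨-((m + c) / (2 * c)), abs_le.2 ⟨by linarith, by linarith⟩⟩

theorem isPrincipal_span_pair (hdiscr : b ^ 2 + 4 * a < 0)
    (hred : OnlyPrincipalReduced (b ^ 2 + 4 * a)) {c k : ℤ} (hc : 0 < c)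
    (hdvd : c ∣ norm (⟨k, 1⟩ : QuadraticAlgebra ℤ a b)) :
    (span {.C c, ⟨k, 1⟩} : Ideal (QuadraticAlgebra ℤ a b)).IsPrincipal := by
  have := isDomain_of_discr_neg hdiscr
  induction hn : c.toNat using Nat.strong_induction_on generalizing c k with
  | _ n ih =>
    wlog hk : |2 * k + b| ≤ c generalizing k
    · obtain ⟨t, ht⟩ := exists_abs_add_two_mul_mul_le (2 * k + b) hc
      rw [← span_pair_add_mul c k t]
      refine this ?_ (by convert ht using 2; ring)
      have hnorm : norm (⟨k + c * t, 1⟩ : QuadraticAlgebra ℤ a b) =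
          norm (⟨k, 1⟩ : QuadraticAlgebra ℤ a b) + c * (t * (2 * k + c * t + b)) := by
        simp only [norm_def]
        ring
      exact hnorm ▸ hdvd.add (dvd_mul_right _ _)
    obtain ⟨c', hnorm⟩ := hdvd
    have hform : (2 * k + b) ^ 2 - 4 * c * c' = b ^ 2 + 4 * a := by
      rw [norm_def] at hnorm
      linear_combination 4 * hnorm
    have hc' : 0 < c' := by
      by_contra! h
      nlinarith [sq_nonneg (2 * k + b)]
    rcases le_or_gt c c' with hle | hlt
    · rw [hred c (2 * k + b) c' hc hk hle hform, QuadraticAlgebra.C_one, span_insert,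
        span_singleton_one, top_sup_eq]
      exact top_isPrincipal
    · have hnorm' : norm (⟨-(k + b), 1⟩ : QuadraticAlgebra ℤ a b) = c' * c := by
        rw [mul_comm, ← hnorm, norm_def, norm_def]
        ring
      refine isPrincipal_of_span_singleton_mul_eq ?_ (span_star_mul_span_pair hnorm)
        (ih c'.toNat (by omega) hc' ⟨c, hnorm'⟩ rfl)
      exact star_ne_zero.2 fun h => one_ne_zero (congrArg QuadraticAlgebra.im h)

theorem isPrincipalIdealRing_of_onlyPrincipalReduced (hdiscr : b ^ 2 + 4 * a < 0)
    (hred : OnlyPrincipalReduced (b ^ 2 + 4 * a)) :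
    IsPrincipalIdealRing (QuadraticAlgebra ℤ a b) := by
  refine ⟨fun I => ?_⟩
  obtain ⟨g, c, k, hdvd, rfl⟩ := exists_eq_span_singleton_mul_span_pair I
  have hc : c ≠ 0 := by
    rintro rfl
    rw [zero_dvd_iff, norm_eq_zero_iff_of_discr_neg hdiscr] at hdvd
    exact one_ne_zero (congrArg QuadraticAlgebra.im hdvd)
  obtain ⟨d, hd⟩ : (span {.C c, ⟨k, 1⟩} : Ideal (QuadraticAlgebra ℤ a b)).IsPrincipal := by
    rcases hc.lt_or_gt with hneg | hpos
    · rw [span_pair_comm, ← span_pair_neg, ← QuadraticAlgebra.C_neg, span_pair_comm]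
      exact isPrincipal_span_pair hdiscr hred (neg_pos.2 hneg) (neg_dvd.2 hdvd)
    · exact isPrincipal_span_pair hdiscr hred hpos hdvd
  exact ⟨.C g * d, by rw [hd, submodule_span_eq, span_singleton_mul_span_singleton]⟩

end PrincipalIdeal

end QuadraticAlgebra

section QuadOrder

open QuadraticAlgebra

/-- The trace of `omega D`. -/
def omegaTrace (D : ℕ) : ℤ := if D % 4 = 3 then 1 else 0

/-- The norm of `omega D`. The division by `4` is exact. -/
def omegaNorm (D : ℕ) : ℤ := if D % 4 = 3 then (1 + D) / 4 else D

/-- The order `ℤ[ω]` of `ω = omega D`, as an abstract ring; `ringOfIntegersLattice` is the ring of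
integers as a subset of the plane. -/
abbrev QuadOrder (D : ℕ) : Type := QuadraticAlgebra ℤ (-omegaNorm D) (omegaTrace D)

theorem discr_eq (D : ℕ) :
    omegaTrace D ^ 2 + 4 * -omegaNorm D = if D % 4 = 3 then -(D : ℤ) else -4 * (D : ℤ) := by
  unfold omegaTrace omegaNorm
  split_ifs <;> omega

theorem discr_neg (D : ℕ) [NeZero D] : omegaTrace D ^ 2 + 4 * -omegaNorm D < 0 := by
  have := NeZero.pos D
  rw [discr_eq]
  split_ifs <;> omega

instance (D : ℕ) [NeZero D] : IsDomain (QuadOrder D) :=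
  isDomain_of_discr_neg (discr_neg D)

theorem onlyPrincipalReduced_discr {D : ℕ}
    (hD : D ∈ ({1, 2, 3, 7, 11, 19, 43, 67, 163} : Set ℕ)) :
    OnlyPrincipalReduced (omegaTrace D ^ 2 + 4 * -omegaNorm D) := by
  intro A B C hA hBA hAC hdisc
  rw [discr_eq] at hdisc
  have hbound : -163 ≤ B ^ 2 - 4 * A * C := by
    rw [hdisc]
    rcases hD with rfl | rfl | rfl | rfl | rfl | rfl | rfl | rfl | rfl <;> norm_num
  obtain ⟨hB1, hB2⟩ := abs_le.1 hBA
  have hA7 : A ≤ 7 := by nlinarith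
  rcases hD with rfl | rfl | rfl | rfl | rfl | rfl | rfl | rfl | rfl <;> norm_num at hdisc <;>
    interval_cases A <;> first | rfl | (interval_cases B <;> omega)

theorem pow_unitCount_eq_one {D : ℕ} [NeZero D] {u : QuadOrder D}
    (hu : u ∈ unitary (QuadOrder D)) : u ^ unitCount D = 1 := by
  have hone := norm_eq_one_iff_mem_unitary.2 hu
  have hdisc := four_mul_norm u
  rw [hone, discr_eq] at hdisc
  rw [norm_def] at hone
  obtain ⟨x, y⟩ := u
  rcases eq_or_ne D 1 with rfl | h1
  · have hxy : x ^ 2 + y ^ 2 = 1 := by simpa [omegaTrace, omegaNorm, sq] using hone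
    obtain ⟨hx1, hx2⟩ : -1 ≤ x ∧ x ≤ 1 := abs_le_of_sq_le_sq' (by nlinarith) zero_le_one
    obtain ⟨hy1, hy2⟩ : -1 ≤ y ∧ y ≤ 1 := abs_le_of_sq_le_sq' (by nlinarith) zero_le_one
    interval_cases x <;> interval_cases y <;> first | omega | rfl
  rcases eq_or_ne D 3 with rfl | h3
  · have hxy : x ^ 2 + x * y + y ^ 2 = 1 := by simpa [omegaTrace, omegaNorm, sq] using hone
    obtain ⟨hx1, hx2⟩ : -1 ≤ x ∧ x ≤ 1 :=
      abs_le_of_sq_le_sq' (by nlinarith [sq_nonneg (x + 2 * y)]) zero_le_one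
    obtain ⟨hy1, hy2⟩ : -1 ≤ y ∧ y ≤ 1 :=
      abs_le_of_sq_le_sq' (by nlinarith [sq_nonneg (2 * x + y)]) zero_le_one
    interval_cases x <;> interval_cases y <;> first | omega | rfl
  · have hdiscr : (if D % 4 = 3 then -(D : ℤ) else -4 * (D : ℤ)) ≤ -7 := by
      have := NeZero.pos D
      split_ifs <;> omega
    obtain rfl : y = 0 := by
      by_contra hy
      nlinarith [sq_nonneg (2 * x + omegaTrace D * y), sq_pos_of_ne_zero hy]
    have hx : x ^ 2 = 1 := by simpa [sq] using hone
    rw [unitCount, if_neg h1, if_neg h3]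
    exact (map_pow (algebraMap ℤ (QuadOrder D)) x 2).symm.trans (hx ▸ map_one _)

theorem exists_isPrimitiveRoot_unitCount (D : ℕ) :
    ∃ ζ ∈ unitary (QuadOrder D), IsPrimitiveRoot ζ (unitCount D) := by
  rcases eq_or_ne D 1 with rfl | h1
  · refine ⟨QuadraticAlgebra.omega, norm_eq_one_iff_mem_unitary.1 rfl,
      .mk_of_lt _ (by decide) rfl fun l hl0 hl => ?_⟩
    change l < 4 at hl
    interval_cases l <;> decide
  rcases eq_or_ne D 3 with rfl | h3
  · refine ⟨QuadraticAlgebra.omega, norm_eq_one_iff_mem_unitary.1 rfl,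
      .mk_of_lt _ (by decide) rfl fun l hl0 hl => ?_⟩
    change l < 6 at hl
    interval_cases l <;> decide
  · refine ⟨-1, norm_eq_one_iff_mem_unitary.1 (by simp), ?_⟩
    rw [unitCount, if_neg h1, if_neg h3]
    exact IsPrimitiveRoot.neg_one 0 (by norm_num)

end QuadOrder

section Embedding

theorem mem_range_of_isIntegralElem {R L : Type*} [CommRing R] [IsDomain R]
    [IsIntegrallyClosed R] [Field L] {f : R →+* L} (hf : Function.Injective f) {z : L}
    (hz : z ∈ Subfield.closure (f.range : Set L)) (hint : f.IsIntegralElem z) : z ∈ f.range := by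
  let : Algebra R L := f.toAlgebra
  let g : FractionRing R →ₐ[R] L := IsFractionRing.liftAlgHom (g := Algebra.ofId R L) hf
  have hrange : (f.range : Set L) ⊆ g.toRingHom.fieldRange := by
    rintro _ ⟨x, rfl⟩
    exact ⟨algebraMap R _ x, g.commutes x⟩
  obtain ⟨w, rfl⟩ := Subfield.closure_le.2 hrange hz
  obtain ⟨x, rfl⟩ := IsIntegrallyClosed.isIntegral_iff.1
    ((isIntegral_algHom_iff g g.toRingHom.injective).1 hint)
  exact ⟨x, (g.commutes x).symm⟩

theorem sqrtNeg_mul_self (D : ℕ) : sqrtNeg D * sqrtNeg D = -(D : ℂ) := by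
  rw [sqrtNeg, mul_mul_mul_comm, Complex.I_mul_I, ← Complex.ofReal_mul,
    Real.mul_self_sqrt D.cast_nonneg, mul_neg_one, Complex.ofReal_natCast]

theorem four_mul_omegaNorm {D : ℕ} (hD : D % 4 = 3) : 4 * omegaNorm D = 1 + D := by
  rw [omegaNorm, if_pos hD]
  omega

theorem omega_mul_self (D : ℕ) :
    omega D * omega D = -omegaNorm D • (1 : ℂ) + omegaTrace D • omega D := by
  by_cases hD : D % 4 = 3
  · have hnorm : (4 : ℂ) * omegaNorm D = 1 + D := mod_cast four_mul_omegaNorm hD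
    simp only [omega, omegaTrace, if_pos hD, zsmul_eq_mul]
    push_cast
    linear_combination sqrtNeg_mul_self D / 4 + hnorm / 4
  · simp only [omega, omegaTrace, omegaNorm, if_neg hD, sqrtNeg_mul_self]
    simp

/-- The embedding of `ℤ[ω]` into `ℂ`. -/
noncomputable def toComplexHom (D : ℕ) : QuadOrder D →ₐ[ℤ] ℂ :=
  QuadraticAlgebra.lift ⟨omega D, omega_mul_self D⟩

/-- The point of the plane whose coordinates are those of `z` in the basis `1, ω`. -/
noncomputable def coords {D : ℕ} (z : QuadOrder D) : ℝ × ℝ := (z.re, z.im)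

theorem coords_injective (D : ℕ) : Function.Injective (coords (D := D)) := fun z w h => by
  simpa [coords, QuadraticAlgebra.ext_iff] using h

theorem toComplex_coords {D : ℕ} (z : QuadOrder D) :
    toComplex D (coords z) = toComplexHom D z := by
  simp [toComplex, coords, toComplexHom, mul_comm]

theorem sqrtNeg_mem_range_toComplexHom (D : ℕ) : sqrtNeg D ∈ (toComplexHom D).range := by
  have hω : omega D ∈ (toComplexHom D).range := ⟨QuadraticAlgebra.omega, by simp [toComplexHom]⟩
  by_cases hD : D % 4 = 3
  · have hsqrt : sqrtNeg D = 2 * omega D - 1 := by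
      rw [omega, if_pos hD]
      ring
    rw [hsqrt]
    exact sub_mem (mul_mem (ofNat_mem _ 2) hω) (one_mem _)
  · rwa [omega, if_neg hD] at hω

theorem toComplexHom_mem_quadField {D : ℕ} (z : QuadOrder D) : toComplexHom D z ∈ quadField D := by
  have hsqrt : sqrtNeg D ∈ quadField D := IntermediateField.mem_adjoin_simple_self ℚ _
  have hω : omega D ∈ quadField D := by
    unfold omega
    split_ifs
    · exact div_mem (add_mem (one_mem _) hsqrt) (ofNat_mem _ 2)
    · exact hsqrt
  rw [← toComplex_coords]
  exact add_mem (intCast_mem _ _) (mul_mem hω (intCast_mem _ _))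

theorem coords_mem_ellipse_iff {D : ℕ} {r : ℝ} {z : QuadOrder D} :
    coords z ∈ ellipse D r ↔ ((QuadraticAlgebra.norm z : ℤ) : ℝ) = r := by
  rw [QuadraticAlgebra.norm_def]
  by_cases hD : D % 4 = 3
  · have hnorm : (4 : ℝ) * omegaNorm D = 1 + D := mod_cast four_mul_omegaNorm hD
    simp only [ellipse, coords, omegaTrace, if_pos hD, ← hnorm, Set.mem_ofPred_eq]
    push_cast
    ring_nf
  · simp only [ellipse, coords, omegaTrace, omegaNorm, if_neg hD, Set.mem_ofPred_eq]
    push_cast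
    ring_nf

variable {D : ℕ} [NeZero D]

theorem toComplex_injective : Function.Injective (toComplex D) := by
  have hsqrt : (sqrtNeg D).im ≠ 0 := by
    simp [sqrtNeg, NeZero.ne D]
  have hω : (omega D).im ≠ 0 := by
    unfold omega
    split_ifs
    · simpa using hsqrt
    · exact hsqrt
  rintro ⟨x, y⟩ ⟨u, v⟩ h
  obtain ⟨hre, him⟩ := Complex.ext_iff.1 h
  obtain rfl : y = v := by simpa [toComplex, hω] using him
  simpa [toComplex] using hre

theorem toComplexHom_injective : Function.Injective (toComplexHom D) := fun z w h =>
  coords_injective D (toComplex_injective (by rwa [toComplex_coords, toComplex_coords]))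

variable [IsIntegrallyClosed (QuadOrder D)]

theorem ringOfIntegersLattice_eq_range_coords :
    ringOfIntegersLattice D = Set.range (coords (D := D)) := by
  ext p
  constructor
  · rintro ⟨a, ha⟩
    have hint : IsIntegral ℤ (toComplex D p) := ha ▸
      (NumberField.RingOfIntegers.isIntegral_coe a).map (IsScalarTower.toAlgHom ℤ (quadField D) ℂ)
    have hfield : toComplex D p ∈ Subfield.closure ((toComplexHom D).toRingHom.range : Set ℂ) := by
      rw [← ha]
      refine IntermediateField.adjoin_le_subfield ℚ {sqrtNeg D} ?_ ?_ (a : quadField D).2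
      · rintro _ ⟨q, rfl⟩
        exact SubfieldClass.ratCast_mem _ q
      · exact Set.singleton_subset_iff.2
          (Subfield.subset_closure (sqrtNeg_mem_range_toComplexHom D))
    have hint' : (toComplexHom D).toRingHom.IsIntegralElem (toComplex D p) :=
      .of_comp (f := algebraMap ℤ (QuadOrder D)) <| by rwa [RingHom.ext_int (RingHom.comp _ _) _]
    obtain ⟨z, hz⟩ := mem_range_of_isIntegralElem toComplexHom_injective hfield hint'
    exact ⟨z, toComplex_injective ((toComplex_coords z).trans hz)⟩
  · rintro ⟨z, rfl⟩
    have hint : IsIntegral ℤ (⟨toComplexHom D z, toComplexHom_mem_quadField z⟩ : quadField D) :=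
      (isIntegral_algebraMap_iff (A := quadField D) (B := ℂ) Subtype.val_injective).1
        ((Algebra.IsIntegral.isIntegral z).map (toComplexHom D))
    exact ⟨⟨_, hint⟩, (toComplex_coords z).symm⟩

theorem exists_norm_eq_of_nonempty_shell {r : ℝ} (hne : (shell D r).Nonempty) :
    ∃ z : QuadOrder D, ((QuadraticAlgebra.norm z : ℤ) : ℝ) = r := by
  obtain ⟨p, hp, hpr⟩ := hne
  rw [ringOfIntegersLattice_eq_range_coords] at hp
  obtain ⟨z, rfl⟩ := hp
  exact ⟨z, coords_mem_ellipse_iff.1 hpr⟩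

theorem shell_norm_eq_image_coords (z : QuadOrder D) :
    shell D (QuadraticAlgebra.norm z : ℤ) = coords '' normShell (z * star z) := by
  ext p
  rw [shell, ringOfIntegersLattice_eq_range_coords,
    ← QuadraticAlgebra.algebraMap_norm_eq_mul_star]
  constructor
  · rintro ⟨⟨w, rfl⟩, hw⟩
    exact ⟨w, mem_normShell_algebraMap.2 (Int.cast_injective (coords_mem_ellipse_iff.1 hw)), rfl⟩
  · rintro ⟨w, hw, rfl⟩
    exact ⟨⟨w, rfl⟩, coords_mem_ellipse_iff.2 (congrArg _ (mem_normShell_algebraMap.1 hw))⟩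

theorem finite_shell_norm (z : QuadOrder D) :
    (shell D (QuadraticAlgebra.norm z : ℤ)).Finite := by
  rw [shell_norm_eq_image_coords]
  exact (finite_normShell_of_discr_neg (discr_neg D) _).image _

theorem finsum_shell_norm_toComplex_pow (z : QuadOrder D) (j : ℕ) :
    ∑ᶠ p ∈ shell D (QuadraticAlgebra.norm z : ℤ), toComplex D p ^ j =
      toComplexHom D (shellPowerSum j (z * star z)) := by
  rw [shell_norm_eq_image_coords, finsum_mem_image (coords_injective D).injOn]
  simp only [toComplex_coords, ← map_pow]
  exact ((toComplexHom D : QuadOrder D →+ ℂ).map_finsum_mem _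
    (finite_normShell_of_discr_neg (discr_neg D) _)).symm

end Embedding

section Design

theorem re_finsum_mem {α : Type*} {s : Set α} (hs : s.Finite) (f : α → ℂ) :
    (∑ᶠ a ∈ s, f a).re = ∑ᶠ a ∈ s, (f a).re :=
  Complex.reAddGroupHom.map_finsum_mem f hs

theorem im_finsum_mem {α : Type*} {s : Set α} (hs : s.Finite) (f : α → ℂ) :
    (∑ᶠ a ∈ s, f a).im = ∑ᶠ a ∈ s, (f a).im :=
  Complex.imAddGroupHom.map_finsum_mem f hs

theorem eval_omegaPow (D j : ℕ) (p : ℝ × ℝ) :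
    eval ![(p.1 : ℂ), (p.2 : ℂ)] (omegaPow D j) = toComplex D p ^ j := by
  simp [omegaPow, toComplex]

theorem forall_mem_harmonicSpace_iff {D j : ℕ} {X : Set (ℝ × ℝ)} (hX : X.Finite) :
    (∀ P ∈ harmonicSpace D j, ∑ᶠ p ∈ X, eval ![p.1, p.2] P = 0) ↔
      ∑ᶠ p ∈ X, toComplex D p ^ j = 0 := by
  let evalSum : MvPolynomial (Fin 2) ℝ →ₗ[ℝ] ℝ :=
    ∑ p ∈ hX.toFinset, (aeval ![p.1, p.2]).toLinearMap
  have hevalSum (P) : ∑ᶠ p ∈ X, eval ![p.1, p.2] P = evalSum P := by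
    rw [finsum_mem_eq_finite_toFinset_sum _ hX, LinearMap.sum_apply]
    rfl
  have hre : evalSum (rePart (omegaPow D j)) = (∑ᶠ p ∈ X, toComplex D p ^ j).re := by
    simp only [← hevalSum, eval_rePart, eval_omegaPow, re_finsum_mem hX]
  have him : evalSum (imPart (omegaPow D j)) = (∑ᶠ p ∈ X, toComplex D p ^ j).im := by
    simp only [← hevalSum, eval_imPart, eval_omegaPow, im_finsum_mem hX]
  calc (∀ P ∈ harmonicSpace D j, ∑ᶠ p ∈ X, eval ![p.1, p.2] P = 0)
      ↔ harmonicSpace D j ≤ LinearMap.ker evalSum := by simp only [hevalSum]; rfl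
    _ ↔ ∑ᶠ p ∈ X, toComplex D p ^ j = 0 := by
        rw [harmonicSpace, Submodule.span_le, Set.pair_subset_iff, SetLike.mem_coe,
          SetLike.mem_coe, LinearMap.mem_ker, LinearMap.mem_ker, hre, him, Complex.ext_iff]
        rfl

theorem hasStrength_setOf_finsum_toComplex_pow_eq_zero {D : ℕ} {r : ℝ} {X : Set (ℝ × ℝ)}
    (hfin : X.Finite) (hne : X.Nonempty) (hX : X ⊆ ellipse D r) :
    HasStrength D r X {j | ∑ᶠ p ∈ X, toComplex D p ^ (j : ℕ) = 0} :=
  ⟨⟨hfin, hne, hX, fun _ hj => (forall_mem_harmonicSpace_iff hfin).2 hj⟩,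
    fun _ hT _ j hj => (forall_mem_harmonicSpace_iff hfin).1 (hT.2.2.2 j hj)⟩

end Design

section Shell

variable {D : ℕ} [NeZero D]

theorem finsum_shell_norm_toComplex_pow_eq_zero [IsIntegrallyClosed (QuadOrder D)]
    (z : QuadOrder D) {j : ℕ} (hj : ¬ unitCount D ∣ j) :
    ∑ᶠ p ∈ shell D (QuadraticAlgebra.norm z : ℤ), toComplex D p ^ j = 0 := by
  obtain ⟨ζ, hζ, hprim⟩ := exists_isPrimitiveRoot_unitCount D
  have hζj : ζ ^ j ≠ 1 := fun h => hj ((hprim.pow_eq_one_iff_dvd j).1 h)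
  rw [finsum_shell_norm_toComplex_pow, shellPowerSum_eq_zero hζ hζj, map_zero]

theorem re_finsum_shell_norm_toComplex_pow_ne_zero [IsPrincipalIdealRing (QuadOrder D)]
    {z : QuadOrder D} (hz : z ≠ 0) {j : ℕ} (hj0 : j ≠ 0) (hj : unitCount D ∣ j) :
    (∑ᶠ p ∈ shell D (QuadraticAlgebra.norm z : ℤ), toComplex D p ^ j).re ≠ 0 := by
  have hfin (n : QuadOrder D) : (normShell n).Finite :=
    finite_normShell_of_discr_neg (discr_neg D) n
  have hunit (u) (hu : u ∈ unitary (QuadOrder D)) : u ^ j = 1 := by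
    obtain ⟨k, rfl⟩ := hj
    rw [pow_mul, pow_unitCount_eq_one hu, one_pow]
  have hsum := shellPowerSum_ne_zero hj0 hfin hunit hz
  have him : (shellPowerSum j (z * star z)).im = 0 :=
    self_eq_neg.1 (congrArg QuadraticAlgebra.im (star_shellPowerSum (hfin _) j)).symm
  rw [finsum_shell_norm_toComplex_pow, ← toComplex_coords]
  simpa [toComplex, coords, QuadraticAlgebra.ext_iff, him] using hsum

theorem designSet_eq_setOf [IsPrincipalIdealRing (QuadOrder D)] {z : QuadOrder D} (hz : z ≠ 0) :
    designSet D =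
      {j : ℕ+ | ∑ᶠ p ∈ shell D (QuadraticAlgebra.norm z : ℤ), toComplex D p ^ (j : ℕ) = 0} :=
  Set.ext fun j => ⟨finsum_shell_norm_toComplex_pow_eq_zero z, fun hsum hj =>
    re_finsum_shell_norm_toComplex_pow_ne_zero hz j.ne_zero hj (by rw [hsum, Complex.zero_re])⟩

end Shell

end EllipsoidalDesign

theorem theorem2 (D : ℕ) (hD : D ∈ ({1, 2, 3, 7, 11, 19, 43, 67, 163} : Set ℕ))
    (r : ℝ) (hr : 0 < r) (hne : (EllipsoidalDesign.shell D r).Nonempty) :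
    EllipsoidalDesign.IsDesign D r (EllipsoidalDesign.shell D r)
        (EllipsoidalDesign.designSet D) ∧
      EllipsoidalDesign.HasStrength D r (EllipsoidalDesign.shell D r)
        (EllipsoidalDesign.designSet D) ∧
      ∀ j : ℕ+, EllipsoidalDesign.unitCount D ∣ (j : ℕ) →
        ∑ᶠ p ∈ EllipsoidalDesign.shell D r,
          ((EllipsoidalDesign.toComplex D p) ^ (j : ℕ)).re ≠ 0 := by
  have : NeZero D := ⟨by rintro rfl; norm_num at hD⟩
  have := EllipsoidalDesign.isPrincipalIdealRing_of_onlyPrincipalReduced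
    (EllipsoidalDesign.discr_neg D) (EllipsoidalDesign.onlyPrincipalReduced_discr hD)
  obtain ⟨z, rfl⟩ := EllipsoidalDesign.exists_norm_eq_of_nonempty_shell hne
  have hz : z ≠ 0 := by
    rintro rfl
    simp at hr
  have hfin := EllipsoidalDesign.finite_shell_norm z
  have hstrength := EllipsoidalDesign.hasStrength_setOf_finsum_toComplex_pow_eq_zero hfin hne
    Set.inter_subset_right
  rw [← EllipsoidalDesign.designSet_eq_setOf hz] at hstrength
  refine ⟨hstrength.prop, hstrength, fun j hj => ?_⟩
  rw [← EllipsoidalDesign.re_finsum_mem hfin]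
  exact EllipsoidalDesign.re_finsum_shell_norm_toComplex_pow_ne_zero hz j.ne_zero hj
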